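/- Let $Q$ be a finite alphabet with at least two letters, and for a word $u\in Q^*$ and $i\in\mathbb Z$ let $[u]_i\subseteq Q^{\mathbb Z}$ be the set of configurations in which $u$ occurs at position $i$. A cellular automaton (CA) $F$ over $Q$ is given by a radius $r\in\mathbb N$ and a local rule $\delta:Q^{2r+1}\to Q$, and acts on $Q^{\mathbb Z}$ by $F(c)_z=\delta(c_{z-r},\dots,c_{z+r})$; $F^2=F\circ F$ is again a CA. A Bernoulli measure on $Q^{\mathbb Z}$ is a probability measure $\mu$ such that $\mu([u]_i)=\prod_{q\in Q}\mu([q]_0)^{|u|_q}$ for all $u\in Q^*$ and $i\in\mathbb Z$, where $|u|_q$ is the number of occurrences of $q$ in $u$; it is fully supported if $\mu([u]_i)>0$ for all $u$ and $i$. The $\mu$-limit set of $F$ is $$\Lambda_\mu(F)=\{c\in Q^{\mathbb Z} : \text{every finite word } u \text{ occurring in } c \text{ satisfies } \mu(F^{-t}([u]_0))\not\to 0 \text{ as } t\to\infty\}.$$ Theorem. For every fully supported Bernoulli measure $\mu$ on $Q^{\mathbb Z}$ there is a cellular automaton $F$ over $Q$ such that $\Lambda_\mu(F)\neq\Lambda_\mu(F^2)$.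 -/

import Mathlib

open MeasureTheory Filter Topology

namespace MuLimit

/-- The wordCylinder `[u]_z`: the configurations `c` with `c_z ⋯ c_{z+|u|-1} = u`. -/
def wordCylinder {Q : Type*} (u : List Q) (z : ℤ) : Set (ℤ → Q) :=
  {c | ∀ (k : ℕ) (hk : k < u.length), c (z + k) = u[k]}

/-- The language `L(c)`: the finite words that occur somewhere in the configuration `c`. -/
def language {Q : Type*} (c : ℤ → Q) : Set (List Q) :=
  {u | ∃ z : ℤ, c ∈ wordCylinder u z}

/-- A (one-dimensional) cellular automaton on the alphabet `Q`: a radius `r` and a local rule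
`Q^(2r+1) → Q`. -/
structure CellularAutomaton (Q : Type*) where
  radius : ℕ
  rule : (Fin (2 * radius + 1) → Q) → Q

namespace CellularAutomaton

/-- The global map: `F(c)_z = δ(c_{z-r}, …, c_z, …, c_{z+r})`. -/
def globalMap {Q : Type*} (F : CellularAutomaton Q) (c : ℤ → Q) : ℤ → Q :=
  fun z => F.rule fun j => c (z - F.radius + (j : ℕ))

/-- The composition `G ∘ F` of two cellular automata, as a cellular automaton whose radius is the
sum of the radii. -/
def comp {Q : Type*} (G F : CellularAutomaton Q) : CellularAutomaton Q where
  radius := G.radius + F.radius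
  rule := fun w => G.rule fun j => F.rule fun i => w ⟨(j : ℕ) + (i : ℕ), by omega⟩

theorem globalMap_comp {Q : Type*} (G F : CellularAutomaton Q) :
    (G.comp F).globalMap = G.globalMap ∘ F.globalMap := by
  funext c z
  simp only [globalMap, comp, Function.comp_apply]
  congr 1
  funext j
  congr 1
  funext i
  congr 1
  push_cast
  ring

end CellularAutomaton

/-- `μ` is a Bernoulli measure: a probability measure on `Q^ℤ` such that
`μ([u]_i) = ∏_q μ([q]_0)^{|u|_q}` for every word `u` and every position `i`. -/
structure IsBernoulli {Q : Type*} [Fintype Q] [DecidableEq Q] [MeasurableSpace Q]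
    (μ : Measure (ℤ → Q)) : Prop where
  isProbabilityMeasure : IsProbabilityMeasure μ
  apply_wordCylinder : ∀ (u : List Q) (i : ℤ),
    μ (wordCylinder u i) = ∏ q : Q, μ (wordCylinder [q] 0) ^ u.count q

/-- `μ` has full support: every wordCylinder has positive measure. -/
def FullSupport {Q : Type*} [MeasurableSpace Q] (μ : Measure (ℤ → Q)) : Prop :=
  ∀ (u : List Q) (i : ℤ), 0 < μ (wordCylinder u i)

/-- The persistent set `L_μ(F)`: the words `u` for which `μ(F^{-t}([u]_0))` does not tend to `0`
as `t → ∞`. -/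
def persistentSet {Q : Type*} [MeasurableSpace Q] (μ : Measure (ℤ → Q))
    (F : CellularAutomaton Q) : Set (List Q) :=
  {u | ¬ Tendsto (fun t : ℕ => μ (F.globalMap^[t] ⁻¹' wordCylinder u 0)) atTop (𝓝 0)}

/-- The `μ`-limit set `Λ_μ(F)`: the configurations all of whose words are persistent. -/
def limitSet {Q : Type*} [MeasurableSpace Q] (μ : Measure (ℤ → Q))
    (F : CellularAutomaton Q) : Set (ℤ → Q) :=
  {c | language c ⊆ persistentSet μ F}

end MuLimit

namespace MuLimit

open ProbabilityTheory

/-! The automaton simulates signed particles, static ones and ones moving right, where a mobile and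
a static particle of opposite signs annihilate on meeting. At every step it also reverses all signs.
The reversal commutes with the dynamics, so after `t` steps one sees the plain annihilation dynamics
with signs reversed `t` times.

If positive particles of each kind are initially more frequent than negative ones of each kind, the
mobile positives wipe out the static negatives (`IsBernoulli.tendsto_measure_static`), while a
positive density of static positives survives (`IsBernoulli.measureReal_sub_le`). So static
negatives are seen with frequency tending to `0` at even times but bounded below at odd times. Some
window decoding to a static negative is thus persistent for `F` but not for `F ∘ F`.

To run this over any alphabet, particles are written as patterns of two letters `a`, `b`, and `F =
encode ∘ flip ∘ annihilate ∘ decode`. The bias comes from decoding: a run of `a`s, impossible in a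
code, yields positive particles, whereas a negative particle requires a correctly coded stretch of
length `2N + 1`, which is rarer for large `N`. -/

/-! ### Local maps and windows. -/

/-- A map between configuration spaces that commutes with translations and whose value at a site
depends only on the sites at distance at most `r`. -/
def IsLocal {A B : Type*} (r : ℕ) (f : (ℤ → A) → (ℤ → B)) : Prop :=
  ∀ (c c' : ℤ → A) (z z' : ℤ), (∀ j : ℤ, |j| ≤ r → c (z + j) = c' (z' + j)) → f c z = f c' z'

/-- The translation of a configuration. -/
def shift {A : Type*} (k : ℤ) (c : ℤ → A) : ℤ → A := fun z => c (k + z)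

/-- The configurations that agree with `c` on `[-n, n]`. -/
def agree {A : Type*} (c : ℤ → A) (n : ℕ) : Set (ℤ → A) := {c' | ∀ z : ℤ, |z| ≤ n → c' z = c z}

/-- The word read in `c` on `[-n, n]`. -/
def window {A : Type*} (c : ℤ → A) (n : ℕ) : List A :=
  List.ofFn fun i : Fin (2 * n + 1) => c (-n + (i : ℕ))

theorem wordCylinder_window {A : Type*} (c : ℤ → A) (n : ℕ) :
    wordCylinder (window c n) (-n) = agree c n := by
  ext c'
  simp only [wordCylinder, window, agree, Set.mem_ofPred_eq, List.length_ofFn, List.getElem_ofFn]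
  constructor
  · intro h z hz
    have hz' := abs_le.1 hz
    have h1 : (((z + n).toNat : ℕ) : ℤ) = z + n := Int.toNat_of_nonneg (by omega)
    have := h (z + n).toNat (by omega)
    rw [h1] at this
    simpa using this
  · intro h k hk
    exact h _ (abs_le.2 ⟨by omega, by omega⟩)

theorem mem_agree_self {A : Type*} (c : ℤ → A) (n : ℕ) : c ∈ agree c n := fun _ _ => rfl

theorem IsLocal.comp {A B C : Type*} {r s : ℕ} {g : (ℤ → B) → (ℤ → C)} {f : (ℤ → A) → (ℤ → B)}
    (hg : IsLocal s g) (hf : IsLocal r f) : IsLocal (s + r) (g ∘ f) := by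
  intro c c' z z' h
  refine hg _ _ _ _ fun j hj => hf _ _ _ _ fun i hi => ?_
  have := h (j + i) ((abs_add_le _ _).trans (by push_cast; omega))
  simpa [add_assoc] using this

theorem IsLocal.iterate {A : Type*} {r : ℕ} {f : (ℤ → A) → (ℤ → A)} (hf : IsLocal r f) (t : ℕ) :
    ∃ s, IsLocal s f^[t] := by
  induction t with
  | zero => exact ⟨0, fun c c' z z' h => by simpa using h 0⟩
  | succ t ih =>
    obtain ⟨s, hs⟩ := ih
    exact ⟨s + r, by rw [Function.iterate_succ]; exact hs.comp hf⟩

theorem IsLocal.apply_shift {A B : Type*} {r : ℕ} {f : (ℤ → A) → (ℤ → B)} (hf : IsLocal r f)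
    (k : ℤ) (c : ℤ → A) : f (shift k c) = shift k (f c) := by
  funext z
  exact hf _ _ _ _ fun j _ => by simp [shift, add_assoc]

theorem CellularAutomaton.isLocal_globalMap {A : Type*} (F : CellularAutomaton A) :
    IsLocal F.radius F.globalMap := by
  intro c c' z z' h
  unfold CellularAutomaton.globalMap
  congr 1
  funext j
  have := h (-F.radius + (j : ℕ)) (abs_le.2 ⟨by omega, by omega⟩)
  simpa [add_assoc, sub_eq_add_neg] using this

/-- Every local map is the global map of a cellular automaton. -/
theorem IsLocal.exists_globalMap_eq {A : Type*} [Inhabited A] {r : ℕ} {f : (ℤ → A) → (ℤ → A)}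
    (hf : IsLocal r f) : ∃ F : CellularAutomaton A, F.globalMap = f := by
  refine ⟨⟨r, fun w => f (fun z =>
    -- The filler outside `[-r, r]` is arbitrary: by locality it cannot affect the value at the
    -- origin.
    if h : 0 ≤ z + r ∧ z ≤ r then w ⟨(z + r).toNat, by omega⟩ else default) 0⟩, ?_⟩
  funext c z
  refine hf _ _ _ _ fun j hj => ?_
  have hj' := abs_le.1 hj
  have h1 : (((0 + j + r).toNat : ℕ) : ℤ) = 0 + j + r := Int.toNat_of_nonneg (by omega)
  rw [dif_pos ⟨by omega, by omega⟩]
  simp only [h1]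
  congr 1
  ring

/-- A map that depends on finitely many coordinates factors through the restriction to them. -/
theorem IsLocal.exists_factor {Q B : Type*} [Inhabited Q] {r : ℕ}
    {f : (ℤ → Q) → (ℤ → B)} (hf : IsLocal r f) (z : ℤ) :
    ∃ g : (Finset.Icc (z - r) (z + r) → Q) → B,
      (fun c => f c z) = fun c => g fun i => c i := by
  refine ⟨fun w => f (fun y => if h : y ∈ Finset.Icc (z - r) (z + r) then w ⟨y, h⟩ else default) z,
    ?_⟩
  funext c
  refine hf _ _ _ _ fun j hj => ?_
  have hj' := abs_le.1 hj
  rw [dif_pos (Finset.mem_Icc.2 ⟨by omega, by omega⟩)]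

theorem IsLocal.measurable {Q B : Type*} [Finite Q] [MeasurableSpace Q]
    [DiscreteMeasurableSpace Q] [MeasurableSpace B] {r : ℕ}
    {f : (ℤ → Q) → (ℤ → B)} (hf : IsLocal r f) (z : ℤ) : Measurable fun c => f c z := by
  rcases isEmpty_or_nonempty Q with h | ⟨⟨q⟩⟩
  · have : IsEmpty (ℤ → Q) := ⟨fun c => h.false (c 0)⟩
    exact measurable_of_empty _
  · have : Inhabited Q := ⟨q⟩
    obtain ⟨g, hg⟩ := hf.exists_factor z
    rw [hg]
    exact (measurable_of_countable g).comp (by fun_prop)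

theorem wordCylinder_singleton {Q : Type*} (q : Q) :
    wordCylinder [q] 0 = (fun c : ℤ → Q => c 0) ⁻¹' {q} := by
  ext c
  simp [wordCylinder]

theorem measurable_shift {Q : Type*} [MeasurableSpace Q] (k : ℤ) :
    Measurable (shift k : (ℤ → Q) → (ℤ → Q)) :=
  measurable_pi_lambda _ fun z => measurable_pi_apply (k + z)

/-! ### Bernoulli measures: product structure, invariance, weak law. -/

section Bernoulli

variable {Q : Type*} [Fintype Q] [DecidableEq Q] [MeasurableSpace Q] [DiscreteMeasurableSpace Q]
  {μ : Measure (ℤ → Q)}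

theorem IsBernoulli.apply_ofFn {Q : Type*} [Fintype Q] [DecidableEq Q] [MeasurableSpace Q]
    {μ : Measure (ℤ → Q)} (hμ : IsBernoulli μ) {n : ℕ} (w : Fin n → Q) (i : ℤ) :
    μ (wordCylinder (List.ofFn w) i) = ∏ k, μ (wordCylinder [w k] 0) := by
  rw [hμ.apply_wordCylinder, ← List.prod_ofFn]
  have := Finset.prod_list_map_count (List.ofFn w) (fun q => μ (wordCylinder [q] 0))
  rw [List.map_ofFn] at this
  rw [show (fun i => μ (wordCylinder [w i] 0)) = (fun q => μ (wordCylinder [q] 0)) ∘ w from rfl,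
    this]
  symm
  refine Finset.prod_subset (Finset.subset_univ _) fun q _ hq => ?_
  rw [List.count_eq_zero_of_not_mem (by simpa using hq), pow_zero]

/-- A Bernoulli measure is the product of its one-letter marginals. -/
theorem IsBernoulli.exists_eq_infinitePi (hμ : IsBernoulli μ) :
    ∃ ν : Measure Q, ∃ _ : IsProbabilityMeasure ν, μ = Measure.infinitePi fun _ : ℤ => ν := by
  have := hμ.isProbabilityMeasure
  let ν : Measure Q := μ.map fun c => c 0
  have hν : IsProbabilityMeasure ν := 
    Measure.isProbabilityMeasure_map (measurable_pi_apply 0).aemeasurable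
  refine ⟨ν, hν, ?_⟩
  have hν1 : ∀ q, μ (wordCylinder [q] 0) = ν {q} := fun q => by
    rw [wordCylinder_singleton, Measure.map_apply (measurable_pi_apply 0) (by measurability)]
  -- Symmetric intervals suffice: they are cofinal among finite sets of sites, and their points are
  -- words.
  have key : ∀ n : ℕ, μ.map (Finset.Icc (-n : ℤ) n).restrict
      = Measure.pi fun _ : Finset.Icc (-n : ℤ) n => ν := by
    intro n
    refine Measure.ext_of_singleton fun w => ?_
    rw [Measure.map_apply (Finset.measurable_restrict _) (by measurability),
      Measure.pi_singleton]
    have h1 := hμ.apply_ofFn (n := 2 * n + 1)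
      (fun k => w ⟨-n + (k : ℕ), Finset.mem_Icc.2 ⟨by omega, by omega⟩⟩) (-n)
    have h2 : (Finset.Icc (-n : ℤ) n).restrict ⁻¹' ({w} : Set (Finset.Icc (-n : ℤ) n → Q)) =
        wordCylinder (List.ofFn fun k : Fin (2 * n + 1) =>
          w ⟨-n + (k : ℕ), Finset.mem_Icc.2 ⟨by omega, by omega⟩⟩) (-n) := by
      ext c
      simp only [Set.mem_preimage, Set.mem_singleton_iff, funext_iff, wordCylinder,
        Set.mem_ofPred_eq, List.length_ofFn, List.getElem_ofFn, Finset.restrict]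
      constructor
      · intro h k hk
        exact h ⟨_, _⟩
      · rintro h ⟨z, hz⟩
        have hz' := Finset.mem_Icc.1 hz
        have h1 : (((z + n).toNat : ℕ) : ℤ) = z + n := Int.toNat_of_nonneg (by omega)
        have := h (z + n).toNat (by omega)
        simpa [h1] using this
    rw [h2, h1]
    simp_rw [hν1]
    refine Fintype.prod_bijective (fun k : Fin (2 * n + 1) =>
      (⟨-n + (k : ℕ), Finset.mem_Icc.2 ⟨by omega, by omega⟩⟩ : Finset.Icc (-n : ℤ) n))
      ⟨fun a b h => ?_, fun ⟨z, hz⟩ => ?_⟩ _ _ fun k => rfl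
    · simp only [Subtype.mk.injEq] at h
      exact Fin.ext (by omega)
    · have hz' := Finset.mem_Icc.1 hz
      exact ⟨⟨(z + n).toNat, by omega⟩, by simp only [Subtype.mk.injEq]; omega⟩
  refine ((Measure.isProjectiveLimit_infinitePi fun _ : ℤ => ν).unique ?_).symm
  intro I
  obtain ⟨n, hn⟩ : ∃ n : ℕ, I ⊆ Finset.Icc (-n : ℤ) n := by
    refine ⟨I.sup Int.natAbs, fun z hz => ?_⟩
    have := Finset.le_sup (f := Int.natAbs) hz
    exact Finset.mem_Icc.2 ⟨by omega, by omega⟩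
  rw [isProjectiveMeasureFamily_pi (fun _ : ℤ => ν) _ _ hn]
  beta_reduce
  rw [← key n,
    Measure.map_map (Finset.measurable_restrict₂ hn) (Finset.measurable_restrict _)]
  rfl

theorem IsBernoulli.map_shift (hμ : IsBernoulli μ) (k : ℤ) : μ.map (shift k) = μ := by
  obtain ⟨ν, hν, rfl⟩ := hμ.exists_eq_infinitePi
  have := Measure.infinitePi_map_piCongrLeft (fun _ : ℤ => ν) (Equiv.addLeft (-k))
  convert! this using 2
  funext c z
  obtain ⟨y, rfl⟩ := (Equiv.addLeft (-k)).surjective z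
  rw [MeasurableEquiv.coe_piCongrLeft, Equiv.piCongrLeft_apply_apply]
  simp [shift]

/-- The distribution of a local map of a Bernoulli configuration is translation invariant. -/
theorem IsBernoulli.measure_eq (hμ : IsBernoulli μ) {B : Type*} [MeasurableSpace B] {r : ℕ}
    {f : (ℤ → Q) → (ℤ → B)} (hf : IsLocal r f) {S : Set B} (hS : MeasurableSet S) (z z' : ℤ) :
    μ {c | f c z ∈ S} = μ {c | f c z' ∈ S} := by
  have h := hμ.map_shift (z - z')
  conv_rhs => rw [← h]
  rw [Measure.map_apply (measurable_shift _) (show MeasurableSet {c | f c z' ∈ S} from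
    hf.measurable z' hS)]
  congr 1
  ext c
  simp [hf.apply_shift, shift]

theorem IsBernoulli.measure_wordCylinder (hμ : IsBernoulli μ) {r : ℕ} {f : (ℤ → Q) → (ℤ → Q)}
    (hf : IsLocal r f) (u : List Q) (z z' : ℤ) :
    μ (f ⁻¹' wordCylinder u z) = μ (f ⁻¹' wordCylinder u z') := by
  -- Occurrence of `u` is itself a local observable, with values in `Prop`.
  have hl : IsLocal u.length (fun c : ℤ → Q => fun z => c ∈ wordCylinder u z) := by
    intro c c' y y' h
    simp only [wordCylinder, Set.mem_ofPred_eq, eq_iff_iff]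
    refine forall₂_congr fun k hk => ?_
    rw [h k (abs_le.2 ⟨by omega, by omega⟩)]
  simpa [Set.preimage] using hμ.measure_eq (hl.comp hf) (S := {p : Prop | p}) (by measurability) z z'

theorem IsBernoulli.integral_eq (hμ : IsBernoulli μ) {r : ℕ}
    {f : (ℤ → Q) → (ℤ → ℝ)} (hf : IsLocal r f) (z z' : ℤ) :
    ∫ c, f c z ∂μ = ∫ c, f c z' ∂μ := by
  have h := hμ.map_shift (z - z')
  conv_rhs => rw [← h]
  rw [integral_map (measurable_shift _).aemeasurable (hf.measurable z').aestronglyMeasurable]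
  congr 1
  funext c
  simp [hf.apply_shift, shift]

theorem IsBernoulli.indepFun [Inhabited Q] (hμ : IsBernoulli μ) {r : ℕ}
    {f : (ℤ → Q) → (ℤ → ℝ)} (hf : IsLocal r f) {z z' : ℤ} (hz : 2 * r < |z - z'|) :
    IndepFun (fun c => f c z) (fun c => f c z') μ := by
  obtain ⟨ν, hν, rfl⟩ := hμ.exists_eq_infinitePi
  obtain ⟨g, hg⟩ := hf.exists_factor z
  obtain ⟨g', hg'⟩ := hf.exists_factor z'
  rw [hg, hg']
  have hi := iIndepFun_infinitePi (P := fun _ : ℤ => ν) (X := fun _ q => q)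
    (fun _ => measurable_id)
  have hd : Disjoint (Finset.Icc (z - r) (z + r)) (Finset.Icc (z' - r) (z' + r)) := by
    rw [Finset.disjoint_left]
    intro y hy hy'
    have h1 := Finset.mem_Icc.1 hy
    have h2 := Finset.mem_Icc.1 hy'
    rcases lt_abs.1 hz with h | h <;> omega
  exact (hi.indepFun_finset _ _ hd fun i => measurable_pi_apply i).comp
    (measurable_of_countable g) (measurable_of_countable g')

/-- A weak law of large numbers: the partial sums of a bounded local observable of positive mean
are positive with probability tending to one. -/
theorem IsBernoulli.tendsto_measure_sum_nonpos [Inhabited Q] (hμ : IsBernoulli μ) {r : ℕ}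
    {f : (ℤ → Q) → (ℤ → ℝ)} (hf : IsLocal r f) (hb : ∀ c z, |f c z| ≤ 1)
    (hpos : 0 < ∫ c, f c 0 ∂μ) :
    Tendsto (fun T : ℕ => μ {c | ∑ z ∈ Finset.Icc (-T : ℤ) 0, f c z ≤ 0}) atTop (𝓝 0) := by
  have := hμ.isProbabilityMeasure
  set e := ∫ c, f c 0 ∂μ
  have hL : ∀ z, MemLp (fun c => f c z) 2 μ := fun z =>
    MemLp.of_bound (hf.measurable z).aestronglyMeasurable 1 (Eventually.of_forall fun c => hb c z)
  -- Sites more than `2r` apart are independent; otherwise both deviations are at most `2`. Hence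
  -- the variance grows linearly in `T`, the squared mean quadratically, and Chebyshev's inequality
  -- applies.
  have hcov : ∀ z z' : ℤ, cov[fun c => f c z, fun c => f c z'; μ] ≤
      if |z - z'| ≤ 2 * r then 4 else 0 := by
    intro z z'
    split_ifs with h
    · have hm : ∀ z, |∫ c, f c z ∂μ| ≤ 1 := fun z => by
        simpa using norm_integral_le_of_norm_le_const (μ := μ) (f := fun c => f c z) (C := 1)
          (Eventually.of_forall fun c => hb c z)
      have h1 : ∀ c z, |f c z - ∫ c, f c z ∂μ| ≤ 2 := fun c z =>
        (abs_sub _ _).trans (by linarith [hb c z, hm z])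
      have h2 := norm_integral_le_of_norm_le_const (μ := μ)
        (f := fun c => (f c z - ∫ c, f c z ∂μ) * (f c z' - ∫ c, f c z' ∂μ)) (C := 4)
        (Eventually.of_forall fun c => by
          rw [Real.norm_eq_abs, abs_mul]
          nlinarith [h1 c z, h1 c z', abs_nonneg (f c z - ∫ c, f c z ∂μ),
            abs_nonneg (f c z' - ∫ c, f c z' ∂μ)])
      exact (le_abs_self _).trans (by simpa [covariance] using h2)
    · exact ((hμ.indepFun hf (not_le.1 h)).covariance_eq_zero (hL z) (hL z')).le
  have hvar : ∀ T : ℕ, Var[fun c => ∑ z ∈ Finset.Icc (-T : ℤ) 0, f c z; μ] ≤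
      (T + 1) * ((4 * r + 1) * 4) := by
    intro T
    rw [variance_fun_sum' fun z _ => hL z]
    have h1 : ∀ z ∈ Finset.Icc (-T : ℤ) 0, ∑ z' ∈ Finset.Icc (-T : ℤ) 0,
        cov[fun c => f c z, fun c => f c z'; μ] ≤ (4 * r + 1) * 4 := by
      intro z _
      refine (Finset.sum_le_sum fun z' _ => hcov z z').trans ?_
      rw [← Finset.sum_filter, Finset.sum_const, nsmul_eq_mul]
      gcongr
      have : (Finset.filter (fun z' => |z - z'| ≤ 2 * (r : ℤ)) (Finset.Icc (-T : ℤ) 0)).card ≤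
          (Finset.Icc (z - 2 * r) (z + 2 * r)).card := by
        refine Finset.card_le_card fun z' hz' => ?_
        have := abs_le.1 (Finset.mem_filter.1 hz').2
        exact Finset.mem_Icc.2 ⟨by omega, by omega⟩
      rw [Int.card_Icc] at this
      have h3 : (z + 2 * r + 1 - (z - 2 * r)).toNat = 4 * r + 1 := by omega
      rw [h3] at this
      exact_mod_cast this
    refine (Finset.sum_le_sum h1).trans ?_
    rw [Finset.sum_const, Int.card_Icc, nsmul_eq_mul]
    have h3 : (0 + 1 - (-T : ℤ)).toNat = T + 1 := by omega
    rw [h3]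
    push_cast
    rfl
  have hmean : ∀ T : ℕ, ∫ c, ∑ z ∈ Finset.Icc (-T : ℤ) 0, f c z ∂μ = (T + 1) * e := by
    intro T
    rw [integral_finsetSum _ fun z _ => (hL z).integrable (by norm_num)]
    rw [Finset.sum_congr rfl fun z _ => hμ.integral_eq hf z 0, Finset.sum_const, Int.card_Icc,
      nsmul_eq_mul]
    have h3 : (0 + 1 - (-T : ℤ)).toNat = T + 1 := by omega
    rw [h3]
    push_cast
    rfl
  have hbound : ∀ T : ℕ, μ {c | ∑ z ∈ Finset.Icc (-T : ℤ) 0, f c z ≤ 0} ≤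
      ENNReal.ofReal ((4 * r + 1) * 4 / e ^ 2 * (1 / ((T : ℝ) + 1))) := by
    intro T
    have hT : (0 : ℝ) < (T + 1) * e := by positivity
    refine (measure_mono ?_).trans
      ((meas_ge_le_variance_div_sq (memLp_finsetSum (Finset.Icc (-T : ℤ) 0) fun z _ => hL z) hT).trans
        (ENNReal.ofReal_le_ofReal ?_))
    · intro c hc
      simp only [Set.mem_ofPred_eq] at hc ⊢
      rw [hmean, abs_of_nonpos (by linarith)]
      linarith
    · calc _ ≤ (T + 1) * ((4 * r + 1) * 4) / ((T + 1) * e) ^ 2 := by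
            gcongr
            exact hvar T
        _ = _ := by
          field_simp
  refine tendsto_of_tendsto_of_tendsto_of_le_of_le tendsto_const_nhds ?_ (fun _ => bot_le)
    hbound
  have := (tendsto_one_div_add_atTop_nhds_zero_nat (𝕜 := ℝ)).const_mul ((4 * r + 1) * 4 / e ^ 2)
  simpa using ENNReal.tendsto_ofReal this

end Bernoulli

/-! ### The particle system and its marks. -/

/-- A cell holds at most one particle of each kind (mobile for `true`, static for `false`), and
every particle has a sign. -/
abbrev Cell := Bool → Option Bool

/-- Particles of the same kind are at distance at least `50`. -/
def Sparse (x : ℤ → Cell) : Prop :=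
  ∀ κ z z', x z κ ≠ none → x z' κ ≠ none → |z - z'| < 50 → z = z'

/-- Mobile particles move one cell to the right, and a mobile and a static particle of opposite
signs annihilate when they meet. -/
def annihilate (x : ℤ → Cell) : ℤ → Cell := fun z κ =>
  if ∃ b, x (z - 1) true = some b ∧ x z false = some (!b) then none
  else x (z - κ.toNat) κ

/-- All signs are reversed. -/
def flip (x : ℤ → Cell) : ℤ → Cell := fun z κ => (x z κ).map (!·)

/-- The positions of the marks that represent a particle of a given kind and sign; all differences
are distinct. -/
def mark : Bool → Bool → Fin 3 → ℤ
  | true, true => ![0, 1, 3]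
  | true, false => ![0, 4, 9]
  | false, true => ![0, 6, 13]
  | false, false => ![0, 8, 18]

theorem mark_mem (κ s : Bool) (i : Fin 3) : 0 ≤ mark κ s i ∧ mark κ s i ≤ 18 := by
  revert κ s i; decide

theorem mark_sub_eq (κ s κ' s' : Bool) (i i' j j' : Fin 3) (hi : i ≠ i')
    (h : mark κ s i - mark κ s i' = mark κ' s' j - mark κ' s' j') : κ' = κ ∧ s' = s ∧ j = i := by
  revert κ s κ' s' i i' j j'; decide +kernel

/-- The site `z` carries a mark of some particle of `x`. -/
def Marked (x : ℤ → Cell) (z : ℤ) : Prop := ∃ κ s i, x (z - mark κ s i) κ = some s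

theorem Sparse.annihilate {x : ℤ → Cell} (hx : Sparse x) : Sparse (annihilate x) := by
  intro κ z z' hz hz' h
  have key : ∀ z, MuLimit.annihilate x z κ ≠ none → x (z - κ.toNat) κ ≠ none := by
    intro z hz
    unfold MuLimit.annihilate at hz
    split_ifs at hz with h
    · exact (hz rfl).elim
    · exact hz
  have := hx κ _ _ (key z hz) (key z' hz') (by simpa using h)
  omega

theorem Sparse.flip {x : ℤ → Cell} (hx : Sparse x) : Sparse (flip x) := by
  intro κ z z' hz hz' h
  exact hx κ z z' (by simpa [MuLimit.flip] using hz) (by simpa [MuLimit.flip] using hz') h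

theorem Sparse.shift {x : ℤ → Cell} (hx : Sparse x) (k : ℤ) : Sparse (shift k x) := by
  intro κ z z' hz hz' h
  have := hx κ _ _ hz hz' (by simpa using h)
  omega

theorem flip_flip (x : ℤ → Cell) : flip (flip x) = x := by
  funext z κ
  simp only [flip]
  cases x z κ <;> simp

/-- The meeting rule only asks for opposite signs, a symmetric condition. -/
theorem annihilate_flip (x : ℤ → Cell) : annihilate (flip x) = flip (annihilate x) := by
  funext z κ
  have h : (∃ b, flip x (z - 1) true = some b ∧ flip x z false = some (!b)) ↔
      ∃ b, x (z - 1) true = some b ∧ x z false = some (!b) := by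
    simp only [flip]
    rcases x (z - 1) true with _ | _ | _ <;> rcases x z false with _ | _ | _ <;> simp
  change (if _ then _ else _) = Option.map (!·) (if _ then _ else _)
  rw [if_congr h rfl rfl]
  split_ifs <;> rfl

theorem isLocal_annihilate : IsLocal 1 annihilate := by
  intro c c' z z' h
  have h0 := h 0 (by simp)
  have h1 := h (-1) (by simp)
  simp only [add_zero, ← sub_eq_add_neg] at h0 h1
  funext κ
  simp only [annihilate, h0, h1]
  cases κ <;> simp [h0, h1]

theorem isLocal_flip : IsLocal 0 flip := by
  intro c c' z z' h
  have h0 := h 0 (by simp)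
  simp only [add_zero] at h0
  funext κ
  simp [flip, h0]

/-- Equally positioned marks at the sites of one particle come from that particle. -/
theorem Sparse.eq_some_of_marked {x' : ℤ → Cell} (hx' : Sparse x') {κ s : Bool} {y : ℤ}
    (h : ∀ i, Marked x' (y + mark κ s i)) : x' y κ = some s := by
  choose κ' s' j hj using h
  -- Of three marks, two belong to particles of one kind. Their positions differ by at most `36 <
  -- 50`, so they are one particle, which the difference of the two marks identifies.
  obtain ⟨i, i', hi, hκ⟩ := Fintype.exists_ne_map_eq_of_card_lt κ' (by simp)
  have h1 := hj i
  have h2 := hj i'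
  rw [← hκ] at h2
  have m1 := mark_mem κ s i
  have m2 := mark_mem κ s i'
  have m3 := mark_mem (κ' i) (s' i) (j i)
  have m4 := mark_mem (κ' i) (s' i') (j i')
  have hp := hx' (κ' i) _ _ (by rw [h1]; simp) (by rw [h2]; simp)
    (abs_lt.2 ⟨by omega, by omega⟩)
  rw [hp, h2] at h1
  have hs : s' i' = s' i := by simpa using h1
  rw [hs] at hp h2
  obtain ⟨e1, e2, e3⟩ := mark_sub_eq κ s (κ' i) (s' i) i i' (j i) (j i') hi (by omega)
  have h1 := hj i
  rw [e1, e2, e3] at h1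
  simpa using h1

theorem Marked.of_eq_some {x : ℤ → Cell} {κ s : Bool} {y : ℤ} (h : x y κ = some s) (i : Fin 3) :
    Marked x (y + mark κ s i) := ⟨κ, s, i, by simpa using h⟩

/-- A sparse configuration is locally determined by its marks. -/
theorem Sparse.apply_eq_of_marked_iff {x x' : ℤ → Cell} (hx : Sparse x) (hx' : Sparse x') {y : ℤ}
    (h : ∀ j, 0 ≤ j → j ≤ 18 → (Marked x (y + j) ↔ Marked x' (y + j))) : x y = x' y := by
  funext κ
  refine Option.ext fun s => ⟨fun hs => ?_, fun hs => ?_⟩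
  · exact hx'.eq_some_of_marked fun i =>
      (h _ (mark_mem κ s i).1 (mark_mem κ s i).2).1 (.of_eq_some hs i)
  · exact hx.eq_some_of_marked fun i =>
      (h _ (mark_mem κ s i).1 (mark_mem κ s i).2).2 (.of_eq_some hs i)

/-- Seven consecutive sites are never all marked by a sparse configuration. -/
theorem Sparse.exists_not_marked {x : ℤ → Cell} (hx : Sparse x) (z : ℤ) :
    ∃ k : Fin 7, ¬ Marked x (z + (k : ℕ)) := by
  by_contra! h
  choose κ s j hj using h
  -- There are only six pairs of a kind and a mark index.
  obtain ⟨k, k', hk, he⟩ := Fintype.exists_ne_map_eq_of_card_lt (fun k => (κ k, j k)) (by simp)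
  simp only [Prod.mk.injEq] at he
  have h1 := hj k
  have h2 := hj k'
  rw [← he.1, ← he.2] at h2
  have m3 := mark_mem (κ k) (s k) (j k)
  have m4 := mark_mem (κ k) (s k') (j k)
  have hp := hx (κ k) _ _ (by rw [h1]; simp) (by rw [h2]; simp)
    (abs_lt.2 ⟨by omega, by omega⟩)
  rw [hp, h2] at h1
  have hs : s k' = s k := by simpa using h1
  rw [hs] at hp
  exact hk (Fin.ext (by omega))

/-! ### Particle counts and survival of static particles. -/

/-- The indicator of a particle of kind `κ` and sign `s`. -/
def count (κ s : Bool) (x : ℤ → Cell) (z : ℤ) : ℤ := if x z κ = some s then 1 else 0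

theorem count_annihilate_true (b : Bool) (x : ℤ → Cell) (z : ℤ) :
    count true b (annihilate x) z =
      count true b x (z - 1) - count true b x (z - 1) * count false (!b) x z := by
  simp only [count, annihilate, Bool.toNat_true, Nat.cast_one]
  rcases x (z - 1) true with _ | _ | _ <;> rcases x z false with _ | _ | _ <;> cases b <;> simp

theorem count_annihilate_false (b : Bool) (x : ℤ → Cell) (z : ℤ) :
    count false (!b) (annihilate x) z =
      count false (!b) x z - count true b x (z - 1) * count false (!b) x z := by
  simp only [count, annihilate, Bool.toNat_false, Nat.cast_zero, sub_zero]
  rcases x (z - 1) true with _ | _ | _ <;> rcases x z false with _ | _ | _ <;> cases b <;> simp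

theorem count_mem (κ s : Bool) (x : ℤ → Cell) (z : ℤ) : count κ s x z = 0 ∨ count κ s x z = 1 := by
  unfold count
  split_ifs <;> simp

/-- The excess of mobile particles of sign `b` on `[-n, 0]` over static particles of sign `!b` on
`[-(n + t), 0]` decreases by at most the outflow at the origin. -/
theorem sum_count_le (b : Bool) (x : ℤ → Cell) (n t : ℕ) :
    ∑ z ∈ Finset.Icc (-(n + 1 : ℕ) : ℤ) 0, count true b x z -
        ∑ z ∈ Finset.Icc (-(n + 1 + t : ℕ) : ℤ) 0, count false (!b) x z ≤
      ∑ z ∈ Finset.Icc (-n : ℤ) 0, count true b (annihilate x) z -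
        ∑ z ∈ Finset.Icc (-(n + 1 + t : ℕ) : ℤ) 0, count false (!b) (annihilate x) z +
        count true b x 0 := by
  simp only [count_annihilate_true, count_annihilate_false, Finset.sum_sub_distrib]
  have h1 : ∑ z ∈ Finset.Icc (-(n + 1 : ℕ) : ℤ) 0, count true b x z =
      ∑ z ∈ Finset.Icc (-n : ℤ) 0, count true b x (z - 1) + count true b x 0 := by
    have h2 : ∑ z ∈ Finset.Icc (-n : ℤ) 0, count true b x (z - 1) =
        ∑ z ∈ Finset.Icc (-(n + 1 : ℕ) : ℤ) (-1), count true b x z := by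
      refine Finset.sum_nbij' (· - 1) (· + 1) ?_ ?_ ?_ ?_ ?_ <;> intro z hz <;>
        simp only [Finset.mem_Icc] at * <;> omega
    rw [h2, add_comm (∑ _ ∈ _, _), ← Finset.sum_insert (by simp)]
    congr 1
    ext z
    simp only [Finset.mem_insert, Finset.mem_Icc]
    omega
  -- Each product is one annihilation; the wider static window sees at least as many of them.
  have h3 : ∑ z ∈ Finset.Icc (-n : ℤ) 0, count true b x (z - 1) * count false (!b) x z ≤
      ∑ z ∈ Finset.Icc (-(n + 1 + t : ℕ) : ℤ) 0,
        count true b x (z - 1) * count false (!b) x z := by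
    refine Finset.sum_le_sum_of_subset_of_nonneg (Finset.Icc_subset_Icc (by omega) le_rfl)
      fun z _ _ => ?_
    rcases count_mem true b x (z - 1) with h | h <;>
      rcases count_mem false (!b) x z with h' | h' <;> simp [h, h']
  linarith

theorem static_of_annihilate {x : ℤ → Cell} {z : ℤ} {s : Bool}
    (h : annihilate x z false = some s) : x z false = some s ∧ x (z - 1) true ≠ some (!s) := by
  unfold annihilate at h
  split_ifs at h with h'
  simp only [Bool.toNat_false, Nat.cast_zero, sub_zero] at h
  refine ⟨h, fun hm => h' ⟨!s, hm, by simpa using h⟩⟩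

theorem static_of_iterate {x : ℤ → Cell} {z : ℤ} {s : Bool} {t : ℕ}
    (h : annihilate^[t] x z false = some s) : x z false = some s := by
  induction t with
  | zero => exact h
  | succ t ih =>
    rw [Function.iterate_succ_apply'] at h
    exact ih (static_of_annihilate h).1

/-- The mobile window shrinks by one site per step while the static window stays fixed; `t` counts
the steps already made. The `-1` is the survivor at the origin, and `count true b x 0` allows for a
mobile particle that starts there and leaves without meeting it. -/
theorem sum_count_le_of_survives (b : Bool) (x : ℤ → Cell) (n t : ℕ)
    (h : annihilate^[n] x 0 false = some (!b)) :
    ∑ z ∈ Finset.Icc (-n : ℤ) 0, count true b x z -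
      ∑ z ∈ Finset.Icc (-(n + t : ℕ) : ℤ) 0, count false (!b) x z ≤ count true b x 0 - 1 := by
  induction n generalizing x t with
  | zero =>
    have h1 : count false (!b) x 0 = 1 := by simpa [count] using h
    have h2 : count false (!b) x 0 ≤
        ∑ z ∈ Finset.Icc (-(0 + t : ℕ) : ℤ) 0, count false (!b) x z :=
      Finset.single_le_sum (fun z _ => by rcases count_mem false (!b) x z with h | h <;> simp [h])
        (Finset.mem_Icc.2 ⟨by omega, le_rfl⟩)
    simp only [Nat.cast_zero, neg_zero, Finset.Icc_self, Finset.sum_singleton]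
    omega
  | succ n ih =>
    rw [Function.iterate_succ_apply] at h
    have h1 := ih _ (t + 1) h
    have h2 := sum_count_le b x n t
    -- A mobile particle of sign `b` arriving at the origin would have destroyed the survivor.
    have h3 : count true b (annihilate x) 0 = 0 := by
      have h4 := static_of_annihilate (static_of_iterate h)
      rw [count_annihilate_true]
      simp only [Bool.not_not, zero_sub] at h4
      simp [count, h4.2]
    rw [show n + (t + 1) = n + 1 + t by omega] at h1
    linarith

/-- If a static particle at the origin has survived `T` steps, then the mobile particles of
opposite sign that were initially on `[-T, 0]` did not outnumber the static particles there. -/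
theorem sum_count_nonpos_of_survives (b : Bool) (x : ℤ → Cell) (T : ℕ)
    (h : annihilate^[T] x 0 false = some (!b)) :
    ∑ z ∈ Finset.Icc (-T : ℤ) 0, (count true b x z - count false (!b) x z) ≤ 0 := by
  have h1 := sum_count_le_of_survives b x T 0 h
  rw [Finset.sum_sub_distrib]
  rcases count_mem true b x 0 with h2 | h2 <;> simp only [h2, add_zero] at h1 <;> omega

/-! ### Coding particles by two letters. -/

section Coding

variable {Q : Type*}

open Classical in
/-- The configuration with letter `a` at the marks of `x` and letter `b` elsewhere. -/
noncomputable def encode (a b : Q) (x : ℤ → Cell) : ℤ → Q := fun z => if Marked x z then a else b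

/-- A run of exactly `50` or more letters `a` ends `50` cells to the right of `z`. -/
def Seed (a : Q) (c : ℤ → Q) (z : ℤ) : Prop := (∀ k : ℕ, k < 50 → c (z + k) = a) ∧ c (z + 50) ≠ a

/-- On `[z - N, z + N]` the configuration `c` represents the sparse particle configuration `x`. -/
def Represents (a b : Q) (N : ℕ) (c : ℤ → Q) (z : ℤ) (x : ℤ → Cell) : Prop :=
  Sparse x ∧ ∀ j : ℤ, |j| ≤ N → c (z + j) = encode a b x (z + j)

open Classical in
/-- The particles read off from an arbitrary configuration: a seed yields two positive particles,
and elsewhere only particles surrounded by a long correctly coded stretch are kept. -/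
noncomputable def decode (a b : Q) (N : ℕ) (c : ℤ → Q) : ℤ → Cell := fun z =>
  if Seed a c z then fun _ => some true
  else if h : ∃ x, Represents a b N c z x then h.choose z else fun _ => none

variable {a b : Q} {N : ℕ}

theorem isLocal_encode : IsLocal 18 (encode a b) := by
  intro c c' z z' h
  unfold encode
  have : Marked c z ↔ Marked c' z' := by
    refine exists_congr fun κ => exists_congr fun s => exists_congr fun i => ?_
    have m := mark_mem κ s i
    have := h (-mark κ s i) (abs_le.2 ⟨by push_cast; omega, by push_cast; omega⟩)
    rw [sub_eq_add_neg, sub_eq_add_neg, this]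
  by_cases hm : Marked c z
  · rw [if_pos hm, if_pos (this.1 hm)]
  · rw [if_neg hm, if_neg (mt this.2 hm)]

theorem encode_eq_encode_iff (hab : a ≠ b) {x x' : ℤ → Cell} {z z' : ℤ} :
    encode a b x z = encode a b x' z' ↔ (Marked x z ↔ Marked x' z') := by
  unfold encode
  by_cases h : Marked x z <;> by_cases h' : Marked x' z' <;> simp [h, h', hab, hab.symm]

theorem Sparse.exists_encode_ne (hab : a ≠ b) {x : ℤ → Cell} (hx : Sparse x) (z : ℤ) :
    ∃ k : ℕ, k < 7 ∧ encode a b x (z + k) ≠ a := by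
  obtain ⟨k, hk⟩ := hx.exists_not_marked z
  exact ⟨k, k.2, by simp [encode, hk, hab.symm]⟩

theorem Represents.exists_ne (hab : a ≠ b) {c : ℤ → Q} {z z' : ℤ} {x : ℤ → Cell}
    (h : Represents a b N c z x) (h1 : z - N ≤ z') (h2 : z' + 6 ≤ z + N) :
    ∃ k : ℕ, k < 7 ∧ c (z' + k) ≠ a := by
  obtain ⟨k, hk, hne⟩ := h.1.exists_encode_ne hab z'
  refine ⟨k, hk, ?_⟩
  have := h.2 (z' + k - z) (abs_le.2 ⟨by omega, by omega⟩)
  rw [show z + (z' + k - z) = z' + k by ring] at this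
  rwa [this]

theorem Represents.not_seed (hab : a ≠ b) {c : ℤ → Q} {z z' : ℤ} {x : ℤ → Cell}
    (h : Represents a b N c z x) (h1 : z - N ≤ z') (h2 : z' + 6 ≤ z + N) : ¬ Seed a c z' := by
  obtain ⟨k, hk, hne⟩ := h.exists_ne hab h1 h2
  exact fun hs => hne (hs.1 k (by omega))

/-- The marks on `[y, y + 18]` determine the cell at `y`, so overlapping representations agree. In
particular the choice made in `decode` is immaterial. -/
theorem Represents.apply_eq (hab : a ≠ b) {c : ℤ → Q} {z z' y : ℤ} {x x' : ℤ → Cell}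
    (h : Represents a b N c z x) (h' : Represents a b N c z' x') (h1 : z - N ≤ y)
    (h2 : y + 18 ≤ z + N) (h1' : z' - N ≤ y) (h2' : y + 18 ≤ z' + N) : x y = x' y := by
  refine h.1.apply_eq_of_marked_iff h'.1 fun j hj hj' => ?_
  have e1 := h.2 (y + j - z) (abs_le.2 ⟨by omega, by omega⟩)
  have e2 := h'.2 (y + j - z') (abs_le.2 ⟨by omega, by omega⟩)
  rw [show z + (y + j - z) = y + j by ring] at e1
  rw [show z' + (y + j - z') = y + j by ring] at e2
  exact (encode_eq_encode_iff hab).1 (e1.symm.trans e2)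

theorem Represents.decode_eq (hab : a ≠ b) (hN : 100 ≤ N) {c : ℤ → Q} {z : ℤ} {x : ℤ → Cell}
    (h : Represents a b N c z x) : decode a b N c z = x z := by
  have hex : ∃ x, Represents a b N c z x := ⟨x, h⟩
  rw [decode, if_neg (h.not_seed hab (by omega) (by omega)), dif_pos hex]
  exact hex.choose_spec.apply_eq hab h (by omega) (by omega) (by omega) (by omega)

theorem decode_encode (hab : a ≠ b) (hN : 100 ≤ N) {x : ℤ → Cell} (hx : Sparse x) :
    decode a b N (encode a b x) = x := by
  funext z
  exact Represents.decode_eq hab hN ⟨hx, fun _ _ => rfl⟩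

theorem decode_of_seed {c : ℤ → Q} {z : ℤ} (h : Seed a c z) (κ : Bool) :
    decode a b N c z κ = some true := by
  rw [decode, if_pos h]

theorem seed_or_represents {c : ℤ → Q} {z : ℤ} {κ : Bool} (h : decode a b N c z κ ≠ none) :
    Seed a c z ∨ ∃ x, Represents a b N c z x := by
  by_contra! h'
  rw [decode, if_neg h'.1, dif_neg (by simpa using h'.2)] at h
  exact h rfl

theorem represents_of_decode_eq_some_false {c : ℤ → Q} {z : ℤ} {κ : Bool}
    (h : decode a b N c z κ = some false) : ∃ x, Represents a b N c z x := by
  rcases seed_or_represents (by rw [h]; simp) with hs | hr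
  · rw [decode_of_seed hs] at h
    simp at h
  · exact hr

/-- Two seeds less than `50` apart would put the end of one run inside the other. A seed cannot
start near the centre of a coded stretch, which has no seven consecutive `a`s. Two nearby coded
centres read the same sparse configuration. -/
theorem sparse_decode (hab : a ≠ b) (hN : 100 ≤ N) (c : ℤ → Q) : Sparse (decode a b N c) := by
  intro κ z z' hz hz' h
  have h' := abs_lt.1 h
  rcases seed_or_represents hz with hs | ⟨x, hx⟩ <;>
    rcases seed_or_represents hz' with hs' | ⟨x', hx'⟩
  · have key : ∀ y y' : ℤ, y < y' → y' - y < 50 → Seed a c y → ¬ Seed a c y' := by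
      intro y y' h1 h2 hy hy'
      have h3 : (((y + 50 - y').toNat : ℕ) : ℤ) = y + 50 - y' := Int.toNat_of_nonneg (by omega)
      have := hy'.1 (y + 50 - y').toNat (by omega)
      rw [h3, show y' + (y + 50 - y') = y + 50 by ring] at this
      exact hy.2 this
    rcases lt_trichotomy z z' with hlt | heq | hlt
    · exact (key z z' hlt (by omega) hs hs').elim
    · exact heq
    · exact (key z' z hlt (by omega) hs' hs).elim
  · exact (hx'.not_seed hab (by omega) (by omega) hs).elim
  · exact (hx.not_seed hab (by omega) (by omega) hs').elim
  · rw [hx.decode_eq hab hN] at hz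
    rw [hx'.decode_eq hab hN,
      ← hx.apply_eq hab hx' (by omega) (by omega) (by omega) (by omega)] at hz'
    exact hx.1 κ z z' hz hz' h

theorem isLocal_decode (hab : a ≠ b) (hN : 100 ≤ N) : IsLocal N (decode a b N) := by
  intro c c' z z' h
  -- The chosen representation need not be translation equivariant, but being represented is, and
  -- the decoded cell does not depend on the choice.
  have hrep : ∀ (c c' : ℤ → Q) (z z' : ℤ), (∀ j : ℤ, |j| ≤ N → c (z + j) = c' (z' + j)) → ∀ x,
      Represents a b N c z x → Represents a b N c' z' (shift (z - z') x) := by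
    intro c c' z z' h x hx
    refine ⟨hx.1.shift _, fun j hj => ?_⟩
    rw [isLocal_encode.apply_shift, ← h j hj, hx.2 j hj, shift]
    congr 1
    ring
  have hseed : Seed a c z ↔ Seed a c' z' := by
    unfold Seed
    rw [h 50 (by rw [abs_of_pos] <;> omega)]
    refine and_congr_left fun _ => forall₂_congr fun k hk => ?_
    rw [h k (abs_le.2 ⟨by omega, by omega⟩)]
  by_cases hs : Seed a c z
  · funext κ
    rw [decode_of_seed hs, decode_of_seed (hseed.1 hs)]
  by_cases hr : ∃ x, Represents a b N c z x
  · obtain ⟨x, hx⟩ := hr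
    rw [hx.decode_eq hab hN, (hrep _ _ _ _ h x hx).decode_eq hab hN, shift]
    congr 1
    ring
  · have hr' : ¬ ∃ x, Represents a b N c' z' x := by
      rintro ⟨x, hx⟩
      exact hr ⟨_, hrep _ _ _ _ (fun j hj => (h j hj).symm) x hx⟩
    rw [decode, decode, if_neg hs, if_neg (mt hseed.2 hs), dif_neg hr, dif_neg hr']

end Coding

/-! ### Frequencies of particles. -/

section Statistics

variable {Q : Type*} [Fintype Q] [DecidableEq Q] [MeasurableSpace Q] [DiscreteMeasurableSpace Q]
  {μ : Measure (ℤ → Q)}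

theorem mem_wordCylinder_replicate {Q : Type*} {a : Q} {n : ℕ} {c : ℤ → Q} :
    c ∈ wordCylinder (List.replicate n a) 0 ↔ ∀ k : ℕ, k < n → c (0 + k) = a := by
  simp only [wordCylinder, Set.mem_ofPred_eq, List.length_replicate, List.getElem_replicate]

open Classical in
/-- If `N` is large then correctly coded stretches of length `2 N + 1` are less frequent than
seeds. -/
theorem IsBernoulli.exists_measure_represents_lt [Inhabited Q] (hμ : IsBernoulli μ)
    (hsupp : FullSupport μ) {a b : Q} (hab : a ≠ b) :
    ∃ N : ℕ, 100 ≤ N ∧ μ {c | ∃ x, Represents a b N c 0 x} < μ {c | Seed a c 0} := by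
  have := hμ.isProbabilityMeasure
  let f : (ℤ → Q) → ℤ → ℝ := fun c z => if ∀ k : ℕ, k < 50 → c (z + k) = a then 1 else 0
  have hf : IsLocal 50 f := by
    intro c c' z z' h
    have : (∀ k : ℕ, k < 50 → c (z + k) = a) ↔ ∀ k : ℕ, k < 50 → c' (z' + k) = a := by
      refine forall₂_congr fun k hk => ?_
      rw [h k (abs_le.2 ⟨by push_cast; omega, by push_cast; omega⟩)]
    simp only [f, this]
  have hpos : 0 < ∫ c, f c 0 ∂μ := by
    have h1 : ∫ c, f c 0 ∂μ = μ.real (wordCylinder (List.replicate 50 a) 0) := by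
      have hm : MeasurableSet (wordCylinder (List.replicate 50 a) 0) := by
        have : wordCylinder (List.replicate 50 a) 0 = (fun c => f c 0) ⁻¹' {1} := by
          ext c
          rw [mem_wordCylinder_replicate]
          simp [f]
        rw [this]
        exact hf.measurable 0 (by measurability)
      rw [← integral_indicator_one hm]
      congr 1
      funext c
      simp only [f, Set.indicator_apply, mem_wordCylinder_replicate, Pi.one_apply]
    rw [h1]
    exact ENNReal.toReal_pos (hsupp _ _).ne' (measure_ne_top _ _)
  have hseed : 0 < μ {c | Seed a c 0} := by
    refine (hsupp (List.replicate 50 a ++ [b]) 0).trans_le (measure_mono fun c hc => ⟨?_, ?_⟩)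
    · intro k hk
      rw [hc k (by simp; omega), List.getElem_append_left (by simpa using hk),
        List.getElem_replicate]
    · have := hc 50 (by simp)
      simp only [Nat.cast_ofNat] at this
      rw [this, List.getElem_append_right (by simp)]
      simpa using hab.symm
  -- A coded stretch contains no run of `50` letters `a`, so there the sum of `f` vanishes. By the
  -- weak law this has probability tending to `0`, whereas the probability of a seed does not
  -- involve `N`.
  have hlim := hμ.tendsto_measure_sum_nonpos hf
    (fun c z => by simp only [f]; split_ifs <;> simp) hpos
  obtain ⟨N, hN, hN'⟩ := ((hlim.eventually_lt_const hseed).and (eventually_ge_atTop 100)).exists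
  refine ⟨N, hN', (measure_mono ?_).trans_lt hN⟩
  rintro c ⟨x, hx⟩
  refine (Finset.sum_eq_zero fun z hz => if_neg fun h => ?_ : ∑ z ∈ _, f c z = 0).le
  have hz' := Finset.mem_Icc.1 hz
  obtain ⟨k, hk, hne⟩ := hx.exists_ne hab (z' := z) (by omega) (by omega)
  exact hne (h k (by omega))

theorem isLocal_count (κ s : Bool) :
    IsLocal 0 fun x : ℤ → Cell => fun z => ((count κ s x z : ℤ) : ℝ) := by
  intro c c' z z' h
  have h0 := h 0 (by simp)
  simp only [add_zero] at h0
  simp only [count, h0]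

theorem abs_count_le (κ s : Bool) (x : ℤ → Cell) (z : ℤ) : |((count κ s x z : ℤ) : ℝ)| ≤ 1 := by
  rcases count_mem κ s x z with h | h <;> simp [h]

theorem integrable_count {Q : Type*} [Finite Q] [MeasurableSpace Q]
    [DiscreteMeasurableSpace Q] {μ : Measure (ℤ → Q)} [IsProbabilityMeasure μ] {r : ℕ} {D : (ℤ → Q) → (ℤ → Cell)}
    (hD : IsLocal r D) (κ s : Bool) (z : ℤ) :
    Integrable (fun c => ((count κ s (D c) z : ℤ) : ℝ)) μ :=
  .of_bound (((isLocal_count κ s).comp hD).measurable z).aestronglyMeasurable 1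
    (Eventually.of_forall fun c => abs_count_le κ s (D c) z)

theorem integral_count {Q : Type*} [Finite Q] [MeasurableSpace Q]
    [DiscreteMeasurableSpace Q] {μ : Measure (ℤ → Q)} {r : ℕ} {D : (ℤ → Q) → (ℤ → Cell)}
    (hD : IsLocal r D) (κ s : Bool) (z : ℤ) :
    ∫ c, ((count κ s (D c) z : ℤ) : ℝ) ∂μ = μ.real {c | D c z κ = some s} := by
  have hm : MeasurableSet {c | D c z κ = some s} := by
    have h := ((isLocal_count κ s).comp hD).measurable z (measurableSet_singleton (1 : ℝ))
    convert! h using 1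
    ext c
    simp [count]
  rw [← integral_indicator_one hm]
  congr 1
  funext c
  simp [count, Set.indicator_apply]

/-- If mobile particles of sign `s` are more frequent than static particles of sign `!s`, then the
latter die out. -/
theorem IsBernoulli.tendsto_measure_static [Inhabited Q] (hμ : IsBernoulli μ) {r : ℕ}
    {D : (ℤ → Q) → (ℤ → Cell)} (hD : IsLocal r D) (s : Bool)
    (h : μ {c | D c 0 false = some (!s)} < μ {c | D c 0 true = some s}) :
    Tendsto (fun t => μ {c | annihilate^[t] (D c) 0 false = some (!s)}) atTop (𝓝 0) := by
  have := hμ.isProbabilityMeasure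
  let f : (ℤ → Q) → ℤ → ℝ := fun c z =>
    ((count true s (D c) z : ℤ) : ℝ) - ((count false (!s) (D c) z : ℤ) : ℝ)
  have hf : IsLocal r f := by
    intro c c' z z' h
    simp only [f, count, hD _ _ _ _ h]
  have hpos : 0 < ∫ c, f c 0 ∂μ := by
    rw [integral_sub (integrable_count hD _ _ _) (integrable_count hD _ _ _),
      integral_count hD, integral_count hD, sub_pos]
    exact (ENNReal.toReal_lt_toReal (measure_ne_top _ _) (measure_ne_top _ _)).2 h
  have hb : ∀ c z, |f c z| ≤ 1 := by
    intro c z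
    rcases count_mem true s (D c) z with h | h <;>
      rcases count_mem false (!s) (D c) z with h' | h' <;> simp [f, h, h']
  refine tendsto_of_tendsto_of_tendsto_of_le_of_le tendsto_const_nhds
    (hμ.tendsto_measure_sum_nonpos hf hb hpos) (fun _ => bot_le) fun T => measure_mono ?_
  intro c hc
  have := sum_count_nonpos_of_survives s (D c) T hc
  simp only [Set.mem_ofPred_eq, f]
  exact_mod_cast this

/-- The frequency of static particles of one sign never falls below its initial excess over the
frequency of mobile particles of the other sign. -/
theorem IsBernoulli.measureReal_sub_le [Inhabited Q] (hμ : IsBernoulli μ) {r : ℕ}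
    {D : (ℤ → Q) → (ℤ → Cell)} (hD : IsLocal r D) (s : Bool) (t : ℕ) :
    μ.real {c | D c 0 false = some (!s)} - μ.real {c | D c 0 true = some s} ≤
      μ.real {c | annihilate^[t] (D c) 0 false = some (!s)} := by
  have := hμ.isProbabilityMeasure
  have hl : ∀ t, ∃ q, IsLocal q fun c => annihilate^[t] (D c) := fun t =>
    let ⟨q, hq⟩ := isLocal_annihilate.iterate t
    ⟨_, hq.comp hD⟩
  -- Annihilation removes one particle of each type, so the difference of frequencies is conserved;
  -- translation invariance absorbs the motion.
  have key : ∀ t, μ.real {c | annihilate^[t] (D c) 0 false = some (!s)} -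
      μ.real {c | annihilate^[t] (D c) 0 true = some s} =
      μ.real {c | D c 0 false = some (!s)} - μ.real {c | D c 0 true = some s} := by
    intro t
    induction t with
    | zero => rfl
    | succ t ih =>
      rw [← ih]
      obtain ⟨q, hq⟩ := hl t
      obtain ⟨q', hq'⟩ := hl (t + 1)
      rw [← integral_count hq, ← integral_count hq, ← integral_count hq', ← integral_count hq',
        ← integral_sub (integrable_count hq' _ _ _) (integrable_count hq' _ _ _)]
      have h1 : ∀ c, ((count false (!s) (annihilate^[t + 1] (D c)) 0 : ℤ) : ℝ) -
          ((count true s (annihilate^[t + 1] (D c)) 0 : ℤ) : ℝ) =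
          ((count false (!s) (annihilate^[t] (D c)) 0 : ℤ) : ℝ) -
          ((count true s (annihilate^[t] (D c)) (-1) : ℤ) : ℝ) := by
        intro c
        rw [Function.iterate_succ_apply', count_annihilate_true, count_annihilate_false, zero_sub]
        push_cast
        ring
      simp_rw [h1]
      rw [integral_sub (integrable_count hq _ _ _) (integrable_count hq _ _ _)]
      congr 1
      exact hμ.integral_eq ((isLocal_count true s).comp hq) (-1) 0
  rw [← key t]
  exact sub_le_self _ measureReal_nonneg

end Statistics

/-! ### From persistent words to limit configurations. -/

section Persistence

variable {Q : Type*} [Fintype Q] [DecidableEq Q] [MeasurableSpace Q] [DiscreteMeasurableSpace Q]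
  {μ : Measure (ℤ → Q)}

/-- The word of `c` on `[-n, n]` is persistent under `f`. -/
def PersistsOn {Q : Type*} [MeasurableSpace Q] (μ : Measure (ℤ → Q)) (f : (ℤ → Q) → (ℤ → Q))
    (c : ℤ → Q) (n : ℕ) : Prop :=
  ¬ Tendsto (fun t : ℕ => μ (f^[t] ⁻¹' agree c n)) atTop (𝓝 0)

/-- A window has finitely many extensions by one letter on each side; if all had vanishing measure,
so would their union. -/
theorem PersistsOn.exists_succ {Q : Type*} [Fintype Q] [MeasurableSpace Q]
    {μ : Measure (ℤ → Q)} {f : (ℤ → Q) → (ℤ → Q)} {c : ℤ → Q} {n : ℕ}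
    (h : PersistsOn μ f c n) : ∃ c' ∈ agree c n, PersistsOn μ f c' (n + 1) := by
  by_contra! h'
  let e : Q × Q → ℤ → Q := fun p z =>
    if z = -(n + 1) then p.1 else if z = n + 1 then p.2 else c z
  have he : ∀ p, e p ∈ agree c n := by
    intro p z hz
    have hz' := abs_le.1 hz
    simp only [e]
    rw [if_neg (by omega), if_neg (by omega)]
  have hlim : Tendsto (fun t : ℕ => ∑ p, μ (f^[t] ⁻¹' agree (e p) (n + 1))) atTop (𝓝 0) := by
    have := tendsto_finsetSum (Finset.univ : Finset (Q × Q)) fun p _ => not_not.1 (h' _ (he p))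
    simpa using this
  refine h (tendsto_of_tendsto_of_tendsto_of_le_of_le tendsto_const_nhds hlim (fun _ => bot_le)
    fun t => ?_)
  refine (measure_mono ?_).trans (measure_iUnion_fintype_le _ _)
  intro d hd
  refine Set.mem_iUnion.2 ⟨(f^[t] d (-(n + 1)), f^[t] d (n + 1)), fun z hz => ?_⟩
  have hz' := abs_le.1 hz
  push_cast at hz'
  simp only [e]
  split_ifs with h1 h2
  · rw [h1]
  · rw [h2]
  · exact hd z (abs_le.2 ⟨by omega, by omega⟩)

/-- A persistent word occurs in a configuration of the limit set. -/
theorem PersistsOn.exists_mem_limitSet (hμ : IsBernoulli μ) {F : CellularAutomaton Q}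
    {c : ℤ → Q} {n : ℕ} (h : PersistsOn μ F.globalMap c n) :
    ∃ c' ∈ limitSet μ F, c' ∈ agree c n := by
  let P := fun k => {c : ℤ → Q // PersistsOn μ F.globalMap c (n + k)}
  let next : ∀ k, P k → P (k + 1) := fun k p => ⟨p.2.exists_succ.choose,
    p.2.exists_succ.choose_spec.2⟩
  let seq : ∀ k, P k := Nat.rec ⟨c, h⟩ next
  have hseq : ∀ k, (seq (k + 1)).1 ∈ agree (seq k).1 (n + k) := fun k =>
    (seq k).2.exists_succ.choose_spec.1
  have hle : ∀ k l, k ≤ l → (seq l).1 ∈ agree (seq k).1 (n + k) := by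
    intro k l hkl
    induction l, hkl using Nat.le_induction with
    | base => exact mem_agree_self _ _
    | succ l hkl ih =>
      intro z hz
      rw [hseq l z (hz.trans (by push_cast; omega)), ih z hz]
  -- The letter at `z` is frozen from stage `|z|` on.
  let d : ℤ → Q := fun z => (seq z.natAbs).1 z
  have hd : ∀ k, d ∈ agree (seq k).1 (n + k) := by
    intro k z hz
    rcases le_total k z.natAbs with hk | hk
    · exact hle _ _ hk z hz
    · exact (hle _ _ hk z (by rw [Int.abs_eq_natAbs]; push_cast; omega)).symm
  refine ⟨d, ?_, hd 0⟩
  rintro u ⟨z, hz⟩ hu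
  let k := z.natAbs + u.length
  refine (seq k).2 (tendsto_of_tendsto_of_tendsto_of_le_of_le tendsto_const_nhds hu
    (fun _ => bot_le) fun t => ?_)
  obtain ⟨q, hq⟩ := F.isLocal_globalMap.iterate t
  rw [hμ.measure_wordCylinder hq u 0 z]
  refine measure_mono fun x hx i hi => ?_
  have hi' : |z + (i : ℤ)| ≤ ((n + k : ℕ) : ℤ) := abs_le.2 ⟨by omega, by omega⟩
  rw [hx _ hi', ← hd k _ hi', hz i hi]

end Persistence

/-! ### The automaton and its square. -/

theorem IsBernoulli.exists_limitSet_ne_limitSet_comp {Q : Type*} [Fintype Q] [DecidableEq Q]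
    [Nontrivial Q] [MeasurableSpace Q] [DiscreteMeasurableSpace Q] {μ : Measure (ℤ → Q)}
    (hμ : IsBernoulli μ) (hsupp : FullSupport μ) :
    ∃ F : CellularAutomaton Q, limitSet μ F ≠ limitSet μ (F.comp F) := by
  have := hμ.isProbabilityMeasure
  obtain ⟨a, b, hab⟩ := exists_pair_ne Q
  let _ : Inhabited Q := ⟨a⟩
  obtain ⟨N, hN, hlt⟩ := hμ.exists_measure_represents_lt hsupp hab
  set D := decode a b N
  have hD : IsLocal N D := isLocal_decode hab hN
  let step := MuLimit.flip ∘ annihilate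
  obtain ⟨F, hF⟩ := ((isLocal_encode (a := a) (b := b)).comp
    ((isLocal_flip.comp isLocal_annihilate).comp hD)).exists_globalMap_eq
  have hsemi : Function.Semiconj D F.globalMap step := by
    intro c
    rw [hF]
    exact decode_encode hab hN (sparse_decode hab hN c).annihilate.flip
  have hstep : ∀ t c, D (F.globalMap^[t] c) = MuLimit.flip^[t] (annihilate^[t] (D c)) := by
    intro t c
    rw [(hsemi.iterate_right t).eq]
    have hcomm : Function.Commute MuLimit.flip annihilate := fun x => (annihilate_flip x).symm
    rw [hcomm.comp_iterate, Function.comp_apply]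
  -- The initial bias: negative particles need a coded stretch, and every seed gives a positive one
  -- of each kind.
  have hneg : ∀ κ, μ {c | D c 0 κ = some false} < μ {c | D c 0 true = some true} ∧
      μ {c | D c 0 κ = some false} < μ {c | D c 0 false = some true} := by
    intro κ
    have h1 := (measure_mono (μ := μ) fun c (hc : D c 0 κ = some false) =>
      represents_of_decode_eq_some_false hc).trans_lt hlt
    exact ⟨h1.trans_le (measure_mono fun c hc => decode_of_seed hc true),
      h1.trans_le (measure_mono fun c hc => decode_of_seed hc false)⟩
  have heven : Tendsto (fun t => μ {c | D (F.globalMap^[2 * t] c) 0 false = some false})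
      atTop (𝓝 0) := by
    have h1 := (hμ.tendsto_measure_static hD true (hneg false).1).comp
      (tendsto_id.const_mul_atTop' (show 0 < 2 by norm_num))
    refine h1.congr fun t => ?_
    have h2 : MuLimit.flip^[2 * t] = id :=
      Function.Involutive.iterate_two_mul flip_flip t
    simp [hstep, h2]
  obtain ⟨δ, hδ, hodd⟩ : ∃ δ : ENNReal, 0 < δ ∧
      ∀ t, δ ≤ μ {c | D (F.globalMap^[2 * t + 1] c) 0 false = some false} := by
    refine ⟨ENNReal.ofReal (μ.real {c | D c 0 false = some true} -
      μ.real {c | D c 0 true = some false}), ?_, fun t => ?_⟩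
    · rw [ENNReal.ofReal_pos, sub_pos]
      exact (ENNReal.toReal_lt_toReal (measure_ne_top _ _) (measure_ne_top _ _)).2 (hneg true).2
    · have h1 := hμ.measureReal_sub_le hD false (2 * t + 1)
      refine (ENNReal.ofReal_le_ofReal h1).trans ?_
      rw [ofReal_measureReal]
      refine measure_mono fun c hc => ?_
      have h2 : MuLimit.flip^[2 * t] = id :=
        Function.Involutive.iterate_two_mul flip_flip t
      have hc' : annihilate^[2 * t + 1] (D c) 0 false = some true := hc
      simp only [Set.mem_ofPred_eq, hstep]
      rw [Function.iterate_succ_apply' MuLimit.flip, h2, id, MuLimit.flip, hc']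
      rfl
  -- Finitely many windows on `[-N, N]` decode to a static negative at the origin, and at odd times
  -- their total measure is at least `δ`; so one persists.
  obtain ⟨c, hc, hper⟩ : ∃ c, D c 0 false = some false ∧ PersistsOn μ F.globalMap c N := by
    by_contra! h
    let e : (Finset.Icc (-N : ℤ) N → Q) → ℤ → Q := fun w z =>
      if hz : z ∈ Finset.Icc (-N : ℤ) N then w ⟨z, hz⟩ else a
    have hlim : Tendsto (fun t : ℕ => ∑ w ∈ Finset.univ.filter fun w => D (e w) 0 false = some false,
        μ (F.globalMap^[t] ⁻¹' agree (e w) N)) atTop (𝓝 0) := by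
      have := tendsto_finsetSum (Finset.univ.filter fun w => D (e w) 0 false = some false)
        fun w hw => not_not.1 (h _ (Finset.mem_filter.1 hw).2)
      simpa using this
    obtain ⟨T, hT⟩ := (hlim.eventually_lt_const hδ).exists_forall_of_atTop
    refine ((hodd T).trans ?_).not_gt (hT (2 * T + 1) (by omega))
    refine (measure_mono ?_).trans (measure_biUnion_finset_le _ _)
    intro x hx
    let y := F.globalMap^[2 * T + 1] x
    have hy : y ∈ agree (e fun i => y i) N := by
      intro z hz
      have hz' := abs_le.1 hz
      simp only [e]
      rw [dif_pos (Finset.mem_Icc.2 hz')]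
    refine Set.mem_biUnion (x := fun i : Finset.Icc (-N : ℤ) N => y i)
      (Finset.mem_coe.2 (Finset.mem_filter.2 ⟨Finset.mem_univ _, ?_⟩)) hy
    rw [hD (e fun i => y i) y 0 0 fun j hj => by simpa using (hy j hj).symm]
    exact hx
  obtain ⟨d, hdlim, hd⟩ := hper.exists_mem_limitSet hμ
  have hd0 : D d 0 false = some false := by
    rw [hD d c 0 0 fun j hj => by simpa using hd j hj]
    exact hc
  refine ⟨F, fun heq => ?_⟩
  rw [heq] at hdlim
  refine hdlim (show window d N ∈ language d from
    ⟨-N, by rw [wordCylinder_window]; exact mem_agree_self d N⟩) ?_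
  -- The window of `d` forces a static negative at its centre, an event that vanishes along even
  -- times.
  refine tendsto_of_tendsto_of_tendsto_of_le_of_le tendsto_const_nhds heven (fun _ => bot_le)
    fun t => ?_
  obtain ⟨q, hq⟩ := F.isLocal_globalMap.iterate (2 * t)
  have hit : (F.comp F).globalMap^[t] = F.globalMap^[2 * t] := by
    rw [CellularAutomaton.globalMap_comp, Function.iterate_mul]
    rfl
  beta_reduce
  rw [hit, hμ.measure_wordCylinder hq _ 0 (-N), wordCylinder_window]
  refine measure_mono fun x hx => ?_
  have := hD (F.globalMap^[2 * t] x) d 0 0 fun j hj => by simpa using hx j hj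
  simp only [Set.mem_ofPred_eq, this, hd0]

end MuLimit

theorem mainTheorem12 {Q : Type*} [Fintype Q] [DecidableEq Q] [Nontrivial Q]
    [MeasurableSpace Q] [DiscreteMeasurableSpace Q] (μ : Measure (ℤ → Q))
    (hμ : MuLimit.IsBernoulli μ) (hsupp : MuLimit.FullSupport μ) :
    ∃ F : MuLimit.CellularAutomaton Q,
      MuLimit.limitSet μ F ≠ MuLimit.limitSet μ (F.comp F) := by
  exact hμ.exists_limitSet_ne_limitSet_comp hsupp
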